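/- Let $(R,\mathfrak m)$ be a Noetherian local ring of dimension $d$ and let $q$ be a parameter ideal of $R$, i.e. an ideal generated by $d$ elements with $\sqrt q=\mathfrak m$. Let $H_q:\mathbb Z\to\mathbb Z$, $H_q(n)=\lambda_R(R/q^n)$, be its Hilbert function, where $\lambda_R$ is length and $q^n=R$ for $n\le 0$, so that $H_q(n)=0$ for $n\le 0$. Let $P_q\in\mathbb Q[X]$ be its Hilbert--Samuel polynomial, the unique polynomial with $P_q(n)=H_q(n)$ for all sufficiently large $n$. For a function $f$ on $\mathbb Z$ put $(\Delta f)(n)=f(n+1)-f(n)$, $\Delta^0 f=f$ and $\Delta^{k}f=\Delta(\Delta^{k-1}f)$. Suppose that the associated graded ring $\operatorname{gr}_q(R)=\bigoplus_{n\ge 0}q^n/q^{n+1}$ satisfies $\operatorname{depth}\operatorname{gr}_q(R)\ge d-1$, where depth is the supremum of the lengths of regular sequences in the maximal homogeneous ideal. Then the polynomial $P_q$ exists, and $$(-1)^i\,\bigl(\Delta^{d+1-i}(P_q-H_q)\bigr)(n)\ \ge\ 0$$ for all $0\le i\le d+1$ and all integers $n\ge 1-d$. -/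

import Mathlib

open Filter Polynomial

noncomputable section

namespace HilbertDelta

universe u

/-- The ideal `⨁ Iⁿ⁺¹ tⁿ` of the Rees algebra `R[It] = ⨁ Iⁿ tⁿ`. -/
def initialIdeal {R : Type u} [CommRing R] (I : Ideal R) : Ideal (reesAlgebra I) where
  carrier := {f | ∀ n : ℕ, (f : R[X]).coeff n ∈ I ^ (n + 1)}
  zero_mem' := by intro n; simp
  add_mem' := by
    intro f g hf hg n
    simpa using add_mem (hf n) (hg n)
  smul_mem' := by
    intro c f hf n
    have h : ((c • f : reesAlgebra I) : R[X]) = (c : R[X]) * (f : R[X]) := rfl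
    rw [h, coeff_mul]
    refine sum_mem fun p hp => ?_
    have hp' : p.1 + (p.2 + 1) = n + 1 := by
      have := Finset.HasAntidiagonal.mem_antidiagonal.mp hp
      omega
    rw [← hp', pow_add]
    exact Ideal.mul_mem_mul (c.2 p.1) (hf p.2)

/-- The associated graded ring `gr_I(R) = ⨁ Iⁿ / Iⁿ⁺¹`, with the multiplication induced from the
Rees algebra: the quotient of `⨁ Iⁿ tⁿ` by `⨁ Iⁿ⁺¹ tⁿ`. -/
abbrev AssociatedGraded {R : Type u} [CommRing R] (I : Ideal R) : Type u :=
  reesAlgebra I ⧸ initialIdeal I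

/-- The homogeneous ideal `𝔪/I ⊕ I/I² ⊕ I²/I³ ⊕ ⋯` of `gr_I(R)`; for a proper ideal `I` of the local
ring `R` it is the maximal homogeneous ideal. -/
def homogeneousMaximalIdeal {R : Type u} [CommRing R] [IsLocalRing R] (I : Ideal R) :
    Ideal (AssociatedGraded I) :=
  ((IsLocalRing.maximalIdeal R).comap
    ((constantCoeff : R[X] →+* R).comp (reesAlgebra I).subtype)).map
      (Ideal.Quotient.mk (initialIdeal I))

/-- The depth of `gr_I(R)`: the supremum of the lengths of the `gr_I(R)`-regular sequences whose
terms lie in the maximal homogeneous ideal. -/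
def depthAssociatedGraded {R : Type u} [CommRing R] [IsLocalRing R] (I : Ideal R) : ℕ∞ :=
  ⨆ (rs : List (AssociatedGraded I))
    (_ : (∀ r ∈ rs, r ∈ homogeneousMaximalIdeal I) ∧
      RingTheory.Sequence.IsRegular (AssociatedGraded I) rs), (rs.length : ℕ∞)

/-- A parameter ideal of a local ring `R`: an ideal generated by a full system of parameters, that
is, by `dim R` elements that generate an `𝔪`-primary ideal. -/
def IsParameterIdeal {R : Type u} [CommRing R] [IsLocalRing R] (q : Ideal R) : Prop :=
  ∃ (d : ℕ) (x : Fin d → R), ringKrullDim R = d ∧ q = Ideal.span (Set.range x) ∧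
    q.radical = IsLocalRing.maximalIdeal R

/-- The Hilbert function `H_I(n) = λ_R(R / Iⁿ)`, `n ∈ ℤ`, where `Iⁿ = R` for `n ≤ 0`. (The length is
finite when `I` is primary to the maximal ideal of a Noetherian local ring.) -/
def hilbertFunction {R : Type u} [CommRing R] (I : Ideal R) (n : ℤ) : ℤ :=
  ((Module.length R (R ⧸ I ^ n.toNat)).toNat : ℤ)

/-- `P` is a Hilbert-Samuel polynomial of `I`: `P(n) = H_I(n)` for all large `n`. -/
def IsHilbertSamuelPolynomial {R : Type u} [CommRing R] (I : Ideal R) (P : ℚ[X]) : Prop :=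
  ∀ᶠ n : ℤ in atTop, P.eval (n : ℚ) = (hilbertFunction I n : ℚ)

/-- There is at most one Hilbert-Samuel polynomial. -/
theorem IsHilbertSamuelPolynomial.unique {R : Type u} [CommRing R] {I : Ideal R} {P Q : ℚ[X]}
    (hP : IsHilbertSamuelPolynomial I P) (hQ : IsHilbertSamuelPolynomial I Q) : P = Q := by
  obtain ⟨N, hN⟩ := eventually_atTop.mp (hP.and hQ)
  refine Polynomial.eq_of_infinite_eval_eq P Q ?_
  refine ((Set.Ici_infinite N).image (f := fun n : ℤ => (n : ℚ))
    (Int.cast_injective.injOn)).mono ?_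
  rintro _ ⟨n, hn, rfl⟩
  exact (hN n hn).1.trans (hN n hn).2.symm

open Classical in
/-- The Hilbert-Samuel polynomial `P_I` of `I` (and `0` if `I` has none). -/
def hilbertSamuelPolynomial {R : Type u} [CommRing R] (I : Ideal R) : ℚ[X] :=
  if h : ∃ P : ℚ[X], IsHilbertSamuelPolynomial I P then h.choose else 0

end HilbertDelta

end

noncomputable section

namespace HilbertDelta

/-! The core is the inequality `Δ^{d+1} H_q(n) ≤ 0` for `n ≥ 1 - d`
(`fwdDiff_iter_hilbertFunction_nonpos`). Since `ΔH_q(m)` is the length of `gr_q(R)_m`, the value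
`Δ^{d+1} H_q(m - d)` is the Euler characteristic of the degree `m` strand of the Koszul complex of
the `d` initial forms of the parameters on `gr_q(R)`. Depth at least `d - 1` kills its homology in
degrees `≥ 2`, by `exists_koszulBoundary_eq`. If `m ≥ 1`, then `H_0` vanishes in degree `m` too,
because the initial forms generate all of positive degree. Only `H_1` survives and it counts
negatively.

Lengths are compared without computing homology: the strand is folded into an even and an odd part,
and exactness at the even part bounds its length by that of the odd part (`length_le_of_exact_even`,
`length_strand_le`).

The rest is calculus of differences. As `H_q ≥ 0` is integer valued, `Δ^{d+1} H_q ≤ 0` forces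
`Δ^{d+1} H_q = 0` eventually, so `P_q` exists and `Δ^{d+1} P_q = 0` everywhere. Hence `Δ^{d+1}(P_q -
H_q) ≥ 0` for `n ≥ 1 - d`. Since `P_q - H_q` vanishes for large arguments, descending through the
differences yields the alternating signs. -/

/-- The subsets of `{0, …, k - 1}`, the index set of the basis of the Koszul complex on `k`
elements: a subset of `{0, …, k}` either skips `k` or takes it. -/
inductive KoszulIndex : ℕ → Type
  | nil : KoszulIndex 0
  | skip {k : ℕ} (t : KoszulIndex k) : KoszulIndex (k + 1)
  | take {k : ℕ} (t : KoszulIndex k) : KoszulIndex (k + 1)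

/-! ### Subsets of a finite set and sums over them. -/

namespace KoszulIndex

/-- The cardinality of the subset. -/
def weight : ∀ {k}, KoszulIndex k → ℕ
  | _, nil => 0
  | _, skip t => weight t
  | _, take t => weight t + 1

theorem weight_le {k} (t : KoszulIndex k) : weight t ≤ k := by
  induction t with
  | nil => exact le_rfl
  | skip t ih => exact ih.trans (Nat.le_succ _)
  | take t ih => exact Nat.succ_le_succ ih

/-- The empty subset. -/
def empty : ∀ k, KoszulIndex k
  | 0 => nil
  | k + 1 => skip (empty k)

theorem weight_empty (k : ℕ) : weight (empty k) = 0 := by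
  induction k with
  | zero => rfl
  | succ k ih => exact ih

theorem eq_empty_of_weight_eq_zero {k} (t : KoszulIndex k) (h : weight t = 0) : t = empty k := by
  induction t with
  | nil => rfl
  | skip t ih => exact congrArg skip (ih h)
  | take t ih => exact absurd h (Nat.succ_ne_zero _)

/-- The subsets of `{0, …, k}` as a disjoint union. -/
def succEquiv (k : ℕ) : KoszulIndex (k + 1) ≃ KoszulIndex k ⊕ KoszulIndex k where
  toFun := fun | skip t => Sum.inl t | take t => Sum.inr t
  invFun := Sum.elim skip take
  left_inv := by rintro (t | t) <;> rfl
  right_inv := by rintro (t | t) <;> rfl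

instance instFintype : ∀ k, Fintype (KoszulIndex k)
  | 0 => ⟨{nil}, fun | nil => Finset.mem_singleton_self _⟩
  | k + 1 =>
    haveI := instFintype k
    Fintype.ofEquiv _ (succEquiv k).symm

theorem sum_zero {A : Type*} [AddCommMonoid A] (f : KoszulIndex 0 → A) : ∑ t, f t = f nil :=
  Finset.sum_singleton _ _

theorem sum_succ {A : Type*} [AddCommMonoid A] (k : ℕ) (f : KoszulIndex (k + 1) → A) :
    ∑ t, f t = ∑ t, f (skip t) + ∑ t, f (take t) := by
  rw [← (succEquiv k).symm.sum_comp, Fintype.sum_sum_type]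
  rfl

end KoszulIndex

open KoszulIndex

/-! ### The Koszul complex and its depth sensitivity. -/

section Koszul

variable {S : Type*} [CommRing S] {M M' : Type*} [AddCommGroup M] [Module S M]
  [AddCommGroup M'] [Module S M']

/-- The underlying function of the differential of the Koszul complex. -/
def koszulBoundaryFun (x : ℕ → S) : ∀ {k}, (KoszulIndex k → M) → KoszulIndex k → M
  | 0, _, nil => 0
  | k + 1, v, skip t => koszulBoundaryFun x (fun t => v (skip t)) t + x k • v (take t)
  | _ + 1, v, take t => -koszulBoundaryFun x (fun t => v (take t)) t

/-- The differential of the Koszul complex of `x 0, …, x (k - 1)` on the module `M`. -/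
def koszulBoundary (x : ℕ → S) (k : ℕ) : (KoszulIndex k → M) →ₗ[S] (KoszulIndex k → M) where
  toFun := koszulBoundaryFun x
  map_add' v w := by
    funext t
    induction t with
    | nil => exact (add_zero _).symm
    | skip t ih =>
      have := ih (fun t => v (skip t)) (fun t => w (skip t))
      simp only [Pi.add_apply, koszulBoundaryFun, smul_add] at this ⊢
      refine (congrArg (· + _) this).trans ?_
      abel
    | take t ih =>
      refine (congrArg Neg.neg (ih (fun t => v (take t)) (fun t => w (take t)))).trans ?_
      exact neg_add _ _
  map_smul' r v := by
    funext t
    induction t with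
    | nil => exact (smul_zero r).symm
    | skip t ih =>
      have := ih (fun t => v (skip t))
      simp only [Pi.smul_apply, koszulBoundaryFun, smul_add, RingHom.id_apply] at this ⊢
      refine (congrArg (· + _) this).trans ?_
      rw [smul_comm]
    | take t ih =>
      refine (congrArg Neg.neg (ih (fun t => v (take t)))).trans ?_
      exact (smul_neg r (koszulBoundaryFun x (fun t => v (take t)) t)).symm

variable (x : ℕ → S)

theorem koszulBoundary_skip (k : ℕ) (v : KoszulIndex (k + 1) → M) (t : KoszulIndex k) :
    koszulBoundary x (k + 1) v (skip t) =
      koszulBoundary x k (fun t => v (skip t)) t + x k • v (take t) := rfl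

theorem koszulBoundary_take (k : ℕ) (v : KoszulIndex (k + 1) → M) (t : KoszulIndex k) :
    koszulBoundary x (k + 1) v (take t) = -koszulBoundary x k (fun t => v (take t)) t := rfl

/-- The complex on `k + 1` elements is the mapping cone of `x k` on the complex on `k` elements; the
sign in the `take` component makes the two cross terms cancel. -/
theorem koszulBoundary_koszulBoundary (k : ℕ) (v : KoszulIndex k → M) :
    koszulBoundary x k (koszulBoundary x k v) = 0 := by
  funext t
  induction t with
  | nil => rfl
  | @skip k t ih =>
    rw [koszulBoundary_skip, koszulBoundary_take]
    have e : (fun t => koszulBoundary x (k + 1) v (skip t)) =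
        koszulBoundary x k (fun t => v (skip t)) + x k • fun t => v (take t) := rfl
    rw [e, map_add, Pi.add_apply, ih, map_smul]
    simp
  | @take k t ih =>
    rw [koszulBoundary_take]
    have e : (fun t => koszulBoundary x (k + 1) v (take t)) =
        -koszulBoundary x k (fun t => v (take t)) := rfl
    rw [e, map_neg, Pi.neg_apply, ih]
    simp

/-- The differential commutes with families of additive maps that are compatible with
multiplication by the elements `x j`. -/
theorem map_koszulBoundary {k : ℕ} (p p' : ℕ → M →+ M')
    (h : ∀ i j a, p' i (x j • a) = x j • p (i + 1) a) (v : KoszulIndex k → M)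
    (t : KoszulIndex k) :
    p' (weight t) (koszulBoundary x k v t) =
      koszulBoundary x k (fun s => p (weight s) (v s)) t := by
  induction t generalizing p p' with
  | nil => exact map_zero _
  | skip t ih =>
    rw [koszulBoundary_skip, koszulBoundary_skip, map_add]
    exact congrArg₂ (· + ·) (ih p p' h _) (h _ _ _)
  | take t ih =>
    rw [koszulBoundary_take, koszulBoundary_take, map_neg]
    exact congrArg Neg.neg (ih (fun i => p (i + 1)) (fun i => p' (i + 1))
      (fun i j a => h (i + 1) j a) _)

/-- The elements of the Koszul complex whose components of degree less than `p` vanish. -/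
def VanishesBelow (p : ℕ) {k : ℕ} (v : KoszulIndex k → M) : Prop :=
  ∀ t, weight t < p → v t = 0

/-- All homological degrees live in one module, so degrees are tracked by vanishing conditions: the
differential lowers the degree by one. -/
theorem VanishesBelow.koszulBoundary {p k : ℕ} {v : KoszulIndex k → M}
    (hv : VanishesBelow (p + 1) v) : VanishesBelow p (koszulBoundary x k v) := by
  intro t ht
  induction t generalizing p with
  | nil => rfl
  | skip t ih =>
    rw [koszulBoundary_skip, ih (fun s hs => hv (skip s) hs) ht,
      hv (take t) (Nat.succ_lt_succ ht), smul_zero, add_zero]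
  | take t ih =>
    obtain ⟨p, rfl⟩ := Nat.exists_eq_succ_of_ne_zero (Nat.ne_zero_of_lt ht)
    rw [koszulBoundary_take, ih (p := p) (fun s hs => hv (take s) (Nat.succ_lt_succ hs))
      (Nat.lt_of_succ_lt_succ ht), neg_zero]

/-- The exterior product with the `j`-th basis element. -/
def koszulHomotopy (j : ℕ) : ∀ {k}, (KoszulIndex k → M) → KoszulIndex k → M
  | 0, _, nil => 0
  | k + 1, v, skip t => if j = k then 0 else koszulHomotopy j (fun t => v (skip t)) t
  | k + 1, v, take t => if j = k then v (skip t) else -koszulHomotopy j (fun t => v (take t)) t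

theorem koszulHomotopy_add_smul (j : ℕ) {k : ℕ} (v w : KoszulIndex k → M) (r : S)
    (t : KoszulIndex k) :
    koszulHomotopy j (v + r • w) t = koszulHomotopy j v t + r • koszulHomotopy j w t := by
  induction t with
  | nil => simp [koszulHomotopy]
  | skip t ih =>
    simp only [koszulHomotopy]
    split_ifs
    · simp
    · exact ih _ _
  | take t ih =>
    simp only [koszulHomotopy]
    split_ifs
    · simp
    · refine (congrArg Neg.neg (ih _ _)).trans ?_
      simp [add_comm]

theorem koszulHomotopy_zero (j : ℕ) {k : ℕ} (t : KoszulIndex k) :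
    koszulHomotopy j (0 : KoszulIndex k → M) t = 0 := by
  have := koszulHomotopy_add_smul j (0 : KoszulIndex k → M) 0 (1 : ℤ) t
  simpa using this

theorem koszulHomotopy_neg (j : ℕ) {k : ℕ} (v : KoszulIndex k → M) (t : KoszulIndex k) :
    koszulHomotopy j (-v) t = -koszulHomotopy j v t := by
  have := koszulHomotopy_add_smul j (0 : KoszulIndex k → M) v (-1 : ℤ) t
  simpa [koszulHomotopy_zero] using this

/-- Multiplication by `x j` on the Koszul complex is null-homotopic. -/
theorem koszulBoundary_koszulHomotopy {k j : ℕ} (hj : j < k) (v : KoszulIndex k → M) :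
    koszulBoundary x k (koszulHomotopy j v) + koszulHomotopy j (koszulBoundary x k v) =
      x j • v := by
  funext t
  induction t with
  | nil => omega
  | @skip k t ih =>
    rw [Pi.add_apply, koszulBoundary_skip]
    have e : (fun t => koszulBoundary x (k + 1) v (skip t)) =
        koszulBoundary x k (fun t => v (skip t)) + x k • fun t => v (take t) := rfl
    rcases eq_or_ne j k with rfl | h
    · simp only [koszulHomotopy, if_true, Pi.smul_apply]
      have : (fun _ => 0 : KoszulIndex j → M) = 0 := rfl
      rw [this, map_zero]
      simp
    · simp only [koszulHomotopy, if_neg h, e, koszulHomotopy_add_smul]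
      have := ih (by omega) (fun t => v (skip t))
      simp only [Pi.smul_apply, Pi.add_apply] at this ⊢
      rw [← this]
      simp only [smul_neg]
      abel
  | @take k t ih =>
    rw [Pi.add_apply, koszulBoundary_take]
    have e : (fun t => koszulBoundary x (k + 1) v (take t)) =
        -koszulBoundary x k (fun t => v (take t)) := rfl
    rcases eq_or_ne j k with rfl | h
    · simp only [koszulHomotopy, if_true, Pi.smul_apply, koszulBoundary_skip]
      simp
    · simp only [koszulHomotopy, if_neg h, e, koszulHomotopy_neg]
      have := ih (by omega) (fun t => v (take t))
      have e' : (fun t => -koszulHomotopy j (fun t => v (take t)) t) =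
        -koszulHomotopy j (fun t => v (take t)) := rfl
      rw [e', map_neg]
      simpa using this

theorem VanishesBelow.koszulHomotopy {p k : ℕ} (j : ℕ) {v : KoszulIndex k → M}
    (hv : VanishesBelow p v) : VanishesBelow (p + 1) (koszulHomotopy j v) := by
  intro t ht
  induction t generalizing p with
  | nil => rfl
  | skip t ih =>
    simp only [HilbertDelta.koszulHomotopy]
    split_ifs
    · rfl
    · exact ih (fun s hs => hv (skip s) hs) ht
  | take t ih =>
    simp only [HilbertDelta.koszulHomotopy]
    split_ifs
    · exact hv (skip t) (Nat.lt_of_succ_lt_succ ht)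
    · obtain ⟨p, rfl⟩ := Nat.exists_eq_succ_of_ne_zero
        (Nat.ne_zero_of_lt (Nat.lt_of_succ_lt_succ ht))
      rw [ih (p := p) (fun s hs => hv (take s) (Nat.succ_lt_succ hs))
        (Nat.lt_of_succ_lt_succ ht), neg_zero]

/-- The homology of the Koszul complex is annihilated by the ideal of the elements. -/
theorem exists_koszulBoundary_eq_smul {p k : ℕ} {v : KoszulIndex k → M} (hv : VanishesBelow p v)
    (hv' : koszulBoundary x k v = 0) {r : S} (hr : r ∈ Ideal.span (x '' {j | j < k})) :
    ∃ w, VanishesBelow (p + 1) w ∧ koszulBoundary x k w = r • v := by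
  induction hr using Submodule.span_induction with
  | mem r hr =>
    obtain ⟨j, hj, rfl⟩ := hr
    refine ⟨koszulHomotopy j v, hv.koszulHomotopy j, ?_⟩
    rw [← koszulBoundary_koszulHomotopy x hj v, hv']
    simp [funext_iff, koszulHomotopy_zero]
  | zero => exact ⟨0, fun _ _ => rfl, by simp⟩
  | add r s _ _ hr hs =>
    obtain ⟨w, hw, hw'⟩ := hr
    obtain ⟨u, hu, hu'⟩ := hs
    refine ⟨w + u, fun t ht => ?_, by rw [map_add, hw', hu', add_smul]⟩
    rw [Pi.add_apply, hw t ht, hu t ht, add_zero]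
  | smul a r _ hr =>
    obtain ⟨w, hw, hw'⟩ := hr
    refine ⟨a • w, fun t ht => ?_, by rw [map_smul, hw', smul_assoc]⟩
    rw [Pi.smul_apply, hw t ht, smul_zero]

open RingTheory.Sequence in
/-- Depth sensitivity of the Koszul complex: a weakly regular sequence of length `g` in the radical
of `(x 0, …, x (k - 1))` makes the Koszul homology vanish in degrees above `k - g`. -/
theorem exists_koszulBoundary_eq {k : ℕ} (rs : List S) {M : Type*} [AddCommGroup M] [Module S M]
    (hreg : IsWeaklyRegular M rs)
    (hrad : ∀ r ∈ rs, r ∈ (Ideal.span (x '' {j | j < k})).radical) {p : ℕ}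
    (hp : k < p + rs.length) {v : KoszulIndex k → M} (hv : VanishesBelow p v)
    (hv' : koszulBoundary x k v = 0) :
    ∃ w, VanishesBelow (p + 1) w ∧ koszulBoundary x k w = v := by
  induction rs generalizing p M with
  | nil =>
    refine ⟨0, fun _ _ => rfl, ?_⟩
    rw [map_zero]
    funext t
    exact (hv t ((weight_le t).trans_lt (by simpa using hp))).symm
  | cons r rs ih =>
    rw [isWeaklyRegular_cons_iff] at hreg
    obtain ⟨hr, hrs⟩ := hreg
    -- Division by `r`: `w` is a cycle modulo `r` starting one degree higher, so by induction on `M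
    -- / rM` it is a boundary there. Correcting `w` by a lift makes it divisible by `r`, and `r`
    -- then cancels because it is regular on `M`.
    have key : ∀ z : KoszulIndex k → M, VanishesBelow p z →
        (∃ w, VanishesBelow (p + 1) w ∧ koszulBoundary x k w = r • z) →
        ∃ w, VanishesBelow (p + 1) w ∧ koszulBoundary x k w = z := by
      rintro z hz ⟨w, hw, hwz⟩
      let π : M →ₗ[S] QuotSMulTop r M := Submodule.mkQ _
      have hπ : Function.Surjective π := Submodule.mkQ_surjective _
      have hker : ∀ a, π a = 0 → ∃ b, a = r • b := by
        intro a ha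
        obtain ⟨b, -, hb⟩ := (Submodule.mem_smul_pointwise_iff_exists a r ⊤).mp
          ((Submodule.Quotient.mk_eq_zero _).mp ha)
        exact ⟨b, hb.symm⟩
      have hπr : ∀ a, π (r • a) = 0 := fun a => (Submodule.Quotient.mk_eq_zero _).mpr
        (Submodule.smul_mem_pointwise_smul a r ⊤ trivial)
      have hπd : ∀ u : KoszulIndex k → M,
          koszulBoundary x k (fun t => π (u t)) = fun t => π (koszulBoundary x k u t) :=
        fun u => funext fun t => (map_koszulBoundary x (fun _ => π.toAddMonoidHom)
          (fun _ => π.toAddMonoidHom) (fun i j a => π.map_smul _ _) u t).symm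
      obtain ⟨v', hv', hv'w⟩ := ih (M := QuotSMulTop r M) hrs
        (fun s hs => hrad s (List.mem_cons_of_mem _ hs)) (p := p + 1)
        (by rw [List.length_cons] at hp; omega) (v := fun t => π (w t))
        (fun t ht => (congrArg π (hw t ht)).trans (map_zero π)) (by
          rw [hπd, hwz]
          exact funext fun t => hπr _)
      classical
      choose l hl using hπ
      -- The set-theoretic section `l` need not send `0` to `0`, so the low degrees are cleared by
      -- hand.
      let u : KoszulIndex k → M := fun t => if weight t < p + 1 + 1 then 0 else l (v' t)
      have hu : VanishesBelow (p + 1 + 1) u := fun t ht => if_pos ht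
      have hπu : (fun t => π (u t)) = v' := by
        funext t
        by_cases ht : weight t < p + 1 + 1
        · rw [hu t ht, hv' t ht, map_zero]
        · simp only [u, if_neg ht, hl]
      have hwu : ∀ t, ∃ b, w t - koszulBoundary x k u t = r • b := by
        intro t
        apply hker
        have := congrFun (hπd u) t
        rw [hπu, hv'w] at this
        rw [map_sub, ← this, sub_self]
      choose b hb using hwu
      refine ⟨b, fun t ht => hr ?_, ?_⟩
      · change r • b t = r • 0
        rw [← hb, hw t ht, hu.koszulBoundary x t ht, smul_zero, sub_zero]
      · have e : w - koszulBoundary x k u = r • b := funext hb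
        have e' := congrArg (koszulBoundary x k) e
        rw [map_sub, koszulBoundary_koszulBoundary, sub_zero, map_smul, hwz] at e'
        funext t
        exact hr (congrFun e' t).symm
    -- Only a power `r ^ N` lies in the ideal and annihilates homology; `key` strips off the factors
    -- `r` one by one.
    obtain ⟨N, hN⟩ := hrad r List.mem_cons_self
    have hpow : ∀ (n : ℕ) (z : KoszulIndex k → M), VanishesBelow p z →
        (∃ w, VanishesBelow (p + 1) w ∧ koszulBoundary x k w = r ^ n • z) →
        ∃ w, VanishesBelow (p + 1) w ∧ koszulBoundary x k w = z := by
      intro n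
      induction n with
      | zero => intro z _ h; simpa using h
      | succ n ihn =>
        intro z hz h
        refine ihn z hz (key _ (fun t ht => ?_) ?_)
        · rw [Pi.smul_apply, hz t ht, smul_zero]
        · rwa [← mul_smul, ← pow_succ']
    exact hpow N v hv (exists_koszulBoundary_eq_smul x hv hv' hN)

end Koszul

/-! ### Lengths in a two-periodic complex. -/

section Length

variable {R : Type*} [CommRing R]

theorem length_submodulePi {ι : Type*} [Fintype ι] {M : Type*} [AddCommGroup M] [Module R M]
    (N : ι → Submodule R M) :
    Module.length R (Submodule.pi Set.univ N) = ∑ t, Module.length R (N t) := by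
  rw [← Module.length_pi_of_fintype]
  exact LinearEquiv.length_eq
    { toFun := fun v t => ⟨v.1 t, v.2 t trivial⟩
      invFun := fun v => ⟨fun t => v t, fun t _ => (v t).2⟩
      map_add' := fun _ _ => rfl
      map_smul' := fun _ _ => rfl
      left_inv := fun _ => rfl
      right_inv := fun _ => rfl }

/-- In a `ℤ/2`-graded complex `E ⇄ O` that is exact at `E`, the length of `E` is at most that
of `O`. -/
theorem length_le_of_exact_even {V : Type*} [AddCommGroup V] [Module R V] (D : V →ₗ[R] V)
    (hD : ∀ v, D (D v) = 0) (E O : Submodule R V) (hEO : ∀ v ∈ E, D v ∈ O)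
    (hex : ∀ v ∈ E, D v = 0 → ∃ w ∈ O, D w = v) :
    Module.length R E ≤ Module.length R O := by
  have key : ∀ F : Submodule R V, Module.length R F =
      Module.length R (LinearMap.ker (D.domRestrict F)) +
        Module.length R (LinearMap.range (D.domRestrict F)) := fun F =>
    Module.length_eq_add_of_exact (LinearMap.ker (D.domRestrict F)).subtype
      (D.domRestrict F).rangeRestrict (Submodule.subtype_injective _)
      (LinearMap.surjective_rangeRestrict _) (by
        intro v
        simp [Subtype.ext_iff])
  -- Exactness embeds the kernel on `E` into the image of `O`; `D² = 0` embeds the image of `E` into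
  -- the kernel on `O`.
  rw [key E, key O, add_comm (Module.length R (LinearMap.ker (D.domRestrict O)))]
  refine add_le_add ?_ ?_
  · let f : LinearMap.ker (D.domRestrict E) →ₗ[R] LinearMap.range (D.domRestrict O) :=
      (E.subtype.comp (LinearMap.ker (D.domRestrict E)).subtype).codRestrict _ (by
        rintro ⟨⟨v, hv⟩, hv'⟩
        obtain ⟨w, hw, hw'⟩ := hex v hv hv'
        exact ⟨⟨w, hw⟩, hw'⟩)
    refine Module.length_le_of_injective f ?_
    intro a b h
    have h' : (f a : V) = f b := congrArg Subtype.val h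
    exact Subtype.ext (Subtype.ext h')
  · let f : LinearMap.range (D.domRestrict E) →ₗ[R] LinearMap.ker (D.domRestrict O) :=
      ((LinearMap.range (D.domRestrict E)).subtype.codRestrict O (by
        rintro ⟨_, ⟨v, hv⟩, rfl⟩
        exact hEO v hv)).codRestrict _ (by
        rintro ⟨_, ⟨v, hv⟩, rfl⟩
        exact hD v)
    refine Module.length_le_of_injective f ?_
    intro a b h
    have h' : (((f a : O) : V)) = (f b : O) :=
      congrArg (fun y : LinearMap.ker (D.domRestrict O) => ((y : O) : V)) h
    exact Subtype.ext h'

end Length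

/-! ### Graded strands of the Koszul complex and their Euler characteristic. -/

section Strand

variable {R S : Type*} [CommRing R] [CommRing S] [Algebra R S]

/-- Projection onto homological degree `0` fixes `v`, and the differential intertwines it with the
zero map. -/
theorem koszulBoundary_eq_zero (x : ℕ → S) {k : ℕ} {v : KoszulIndex k → S}
    (hv : ∀ t, weight t ≠ 0 → v t = 0) : koszulBoundary x k v = 0 := by
  funext t
  have h := map_koszulBoundary x (M := S) (M' := S)
    (fun i => if i = 0 then AddMonoidHom.id S else 0) (fun _ => 0) (by intros; simp) v t
  have e : (fun s => (if weight s = 0 then AddMonoidHom.id S else 0) (v s)) = v := by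
    funext s
    split_ifs with hs
    · rfl
    · exact (hv s hs).symm
  rw [e] at h
  exact h.symm

variable (π : ℤ → S →ₗ[R] S)

/-- The projection onto internal degree `m` and homological parity `b` of the Koszul complex, in
homological degree `i`. -/
def strandProjection (m : ℤ) (b i : ℕ) : S →ₗ[R] S := if Even (i + b) then π (m - i) else 0

/-- The part of parity `b` of the degree `m` strand of the Koszul complex. -/
def strand (m : ℤ) (b k : ℕ) : Submodule R (KoszulIndex k → S) :=
  Submodule.pi Set.univ fun t => LinearMap.range (strandProjection π m b (weight t))

variable {π} {x : ℕ → S}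

theorem strandProjection_idem (hidem : ∀ m a, π m (π m a) = π m a) (m : ℤ) (b i : ℕ) (a : S) :
    strandProjection π m b i (strandProjection π m b i a) = strandProjection π m b i a := by
  unfold strandProjection
  split_ifs
  · exact hidem _ _
  · rfl

theorem mem_strand_iff (hidem : ∀ m a, π m (π m a) = π m a) {m : ℤ} {b k : ℕ}
    {v : KoszulIndex k → S} :
    v ∈ strand π m b k ↔ (fun t => strandProjection π m b (weight t) (v t)) = v := by
  constructor
  · intro h
    funext t
    obtain ⟨a, ha⟩ := h t trivial
    rw [← ha, strandProjection_idem hidem]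
  · intro h t _
    exact ⟨v t, congrFun h t⟩

/-- Multiplication by `x j` raises internal degree by one while the differential lowers homological
degree by one, so strands are preserved and the parity flips. -/
theorem strandProjection_smul (hx : ∀ m j a, π m (x j * a) = x j * π (m - 1) a) (m : ℤ) (b b' : ℕ)
    (hb : Even (b + b' + 1)) (i j : ℕ) (a : S) :
    strandProjection π m b i (x j • a) = x j • strandProjection π m b' (i + 1) a := by
  have h : Even (i + b) ↔ Even (i + 1 + b') := by
    simp only [Nat.even_add, Nat.even_add_one] at hb ⊢
    have := Nat.not_even_one
    tauto
  unfold strandProjection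
  by_cases h' : Even (i + b)
  · rw [if_pos h', if_pos (h.mp h'), smul_eq_mul, hx, smul_eq_mul]
    congr 3
    push_cast
    ring
  · rw [if_neg h', if_neg (h'.imp h.mpr)]
    simp

theorem strandProjection_koszulBoundary (hx : ∀ m j a, π m (x j * a) = x j * π (m - 1) a) (m : ℤ)
    (b b' : ℕ) (hb : Even (b + b' + 1)) {k : ℕ} (v : KoszulIndex k → S) :
    (fun t => strandProjection π m b (weight t) (koszulBoundary x k v t)) =
      koszulBoundary x k (fun t => strandProjection π m b' (weight t) (v t)) :=
  funext fun t => map_koszulBoundary x (fun i => (strandProjection π m b' i).toAddMonoidHom)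
    (fun i => (strandProjection π m b i).toAddMonoidHom)
    (fun i j a => strandProjection_smul hx m b b' hb i j a) v t

open RingTheory.Sequence in
/-- The strands in positive degree of the Koszul complex of a graded ring of depth at least
`k - 1` that is generated by `x 0, …, x (k - 1)` have nonpositive Euler characteristic. -/
theorem length_strand_le (hx : ∀ m j a, π m (x j * a) = x j * π (m - 1) a)
    (hidem : ∀ m a, π m (π m a) = π m a) {k : ℕ} {m : ℤ}
    (hgen : ∀ a, π m a ∈ Ideal.span (x '' {j | j < k})) (rs : List S)
    (hreg : IsWeaklyRegular S rs) (hrad : ∀ r ∈ rs, r ∈ (Ideal.span (x '' {j | j < k})).radical)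
    (hk : k < 2 + rs.length) :
    Module.length R (strand π m 0 k) ≤ Module.length R (strand π m 1 k) := by
  classical
  refine length_le_of_exact_even ((koszulBoundary x k).restrictScalars R)
    (fun v => koszulBoundary_koszulBoundary x k v) _ _ ?_ ?_
  · intro v hv
    rw [mem_strand_iff hidem] at hv ⊢
    change (fun t => strandProjection π m 1 (weight t) (koszulBoundary x k v t)) =
      koszulBoundary x k v
    rw [strandProjection_koszulBoundary hx m 1 0 (by decide), hv]
  · intro z hz hz0
    change koszulBoundary x k z = 0 at hz0
    let e : KoszulIndex k → S := Pi.single (empty k) 1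
    have he : ∀ t, weight t ≠ 0 → e t = 0 := fun t ht =>
      Pi.single_eq_of_ne (fun h => ht (by rw [h, weight_empty])) _
    have he0 : koszulBoundary x k e = 0 := koszulBoundary_eq_zero x he
    -- The component in homological degree `0` lies in the ideal of the `x j` by `hgen`, hence `z
    -- (empty k) • e` is a boundary.
    have ha : z (empty k) ∈ Ideal.span (x '' {j | j < k}) := by
      obtain ⟨a, ha⟩ := hz (empty k) trivial
      rw [weight_empty] at ha
      rw [← ha]
      simpa [strandProjection] using hgen a
    obtain ⟨w₀, -, hw₀⟩ := exists_koszulBoundary_eq_smul x (p := 0) (v := e)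
      (fun t ht => absurd ht (Nat.not_lt_zero _)) he0 ha
    -- The remainder has no component in degree `0`, and none in degree `1` because `z` is even, so
    -- the vanishing of homology from degree `2` on applies.
    obtain ⟨w₁, -, hw₁⟩ := exists_koszulBoundary_eq x rs hreg hrad hk
      (v := z - z (empty k) • e) (by
        intro t ht
        rw [Pi.sub_apply, Pi.smul_apply]
        rcases Nat.lt_succ_iff_lt_or_eq.mp ht with ht | ht
        · rw [eq_empty_of_weight_eq_zero t (Nat.lt_one_iff.mp ht)]
          simp [e]
        · obtain ⟨a, ha⟩ := hz t trivial
          rw [he t (by omega), ← ha, ht]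
          simp [strandProjection]) (by rw [map_sub, map_smul, hz0, he0, smul_zero, sub_zero])
    rw [mem_strand_iff hidem] at hz
    -- The preimage `w₀ + w₁` need not lie in the strand; projecting it there does not change its
    -- boundary, since `z` is already in the strand.
    refine ⟨fun t => strandProjection π m 1 (weight t) ((w₀ + w₁) t), ?_, ?_⟩
    · intro t _
      exact ⟨_, rfl⟩
    · change koszulBoundary x k _ = z
      rw [← strandProjection_koszulBoundary hx m 0 1 (by decide), map_add, hw₀, hw₁]
      rwa [add_sub_cancel]

theorem length_strand {g : ℤ → ℕ}
    (hg : ∀ m, Module.length R (LinearMap.range (π m)) = g m) (m : ℤ) (b k : ℕ) :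
    Module.length R (strand π m b k) =
      ((∑ t : KoszulIndex k, if Even (weight t + b) then g (m - weight t) else 0 : ℕ) : ℕ∞) := by
  rw [strand, length_submodulePi, Nat.cast_sum]
  refine Finset.sum_congr rfl fun t _ => ?_
  by_cases h : Even (weight t + b)
  · rw [show strandProjection π m b (weight t) = _ from if_pos h, if_pos h, hg]
  · rw [show strandProjection π m b (weight t) = _ from if_neg h, if_neg h,
      LinearMap.range_zero, Module.length_bot, Nat.cast_zero]

/-- Subsets without the last index contribute the `k`-th difference at `m - k`, those with it minus
the one at `m - 1 - k`. -/
theorem sum_weight_eq_fwdDiff (g : ℤ → ℤ) (k : ℕ) (m : ℤ) :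
    ∑ t : KoszulIndex k, (-1) ^ weight t * g (m - weight t) = (fwdDiff (1 : ℤ))^[k] g (m - k) := by
  induction k generalizing m with
  | zero => simp [sum_zero, weight]
  | succ k ih =>
    rw [sum_succ, Function.iterate_succ_apply', fwdDiff]
    have h1 := ih m
    have h2 := ih (m - 1)
    rw [show m - ((k + 1 : ℕ) : ℤ) + 1 = m - k by push_cast; ring,
      show m - ((k + 1 : ℕ) : ℤ) = m - 1 - k by push_cast; ring, ← h1, ← h2, sub_eq_add_neg,
      ← Finset.sum_neg_distrib]
    refine congrArg₂ (· + ·) rfl (Finset.sum_congr rfl fun t _ => ?_)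
    simp only [weight]
    rw [show m - ((weight t + 1 : ℕ) : ℤ) = m - 1 - weight t by push_cast; ring]
    ring

open RingTheory.Sequence in
/-- The higher differences of the Hilbert function of a graded ring of depth at least `k - 1` that
is generated by `k` elements of degree one. -/
theorem fwdDiff_iter_length_nonpos (hx : ∀ m j a, π m (x j * a) = x j * π (m - 1) a)
    (hidem : ∀ m a, π m (π m a) = π m a) {k : ℕ} {m : ℤ}
    (hgen : ∀ a, π m a ∈ Ideal.span (x '' {j | j < k})) (rs : List S)
    (hreg : IsWeaklyRegular S rs) (hrad : ∀ r ∈ rs, r ∈ (Ideal.span (x '' {j | j < k})).radical)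
    (hk : k < 2 + rs.length) {g : ℤ → ℕ}
    (hg : ∀ m, Module.length R (LinearMap.range (π m)) = g m) :
    (fwdDiff (1 : ℤ))^[k] (fun m => (g m : ℤ)) (m - k) ≤ 0 := by
  have h := length_strand_le (R := R) hx hidem hgen rs hreg hrad hk
  rw [length_strand hg, length_strand hg, Nat.cast_le] at h
  rw [← sum_weight_eq_fwdDiff]
  have h' := (Nat.cast_le (α := ℤ)).mpr h
  rw [← sub_nonpos] at h'
  refine le_trans (le_of_eq ?_) h'
  push_cast
  rw [← Finset.sum_sub_distrib]
  refine Finset.sum_congr rfl fun t _ => ?_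
  rcases Nat.even_or_odd (weight t) with ht | ht
  · have : ¬ Even (weight t + 1) := by simpa [Nat.even_add_one] using ht
    simp [ht, this, ht.neg_one_pow]
  · have h0 : ¬ Even (weight t) := by simpa using ht
    have : Even (weight t + 1) := by simpa [Nat.even_add_one] using h0
    simp [h0, this, ht.neg_one_pow]

end Strand

/-! ### Iterated differences of functions on the integers. -/

theorem eventually_fwdDiff_iter_eq_zero (k : ℕ) {A : Type*} [AddCommGroup A] {f : ℤ → A}
    (hf : ∀ᶠ n in atTop, f n = 0) : ∀ᶠ n in atTop, (fwdDiff (1 : ℤ))^[k] f n = 0 := by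
  induction k with
  | zero => exact hf
  | succ k ih =>
    obtain ⟨N, hN⟩ := eventually_atTop.mp ih
    refine eventually_atTop.mpr ⟨N, fun n hn => ?_⟩
    rw [Function.iterate_succ_apply', fwdDiff, hN n hn, hN (n + 1) (by omega), sub_zero]

theorem antitone_of_fwdDiff_nonpos {A : Type*} [AddCommGroup A] [PartialOrder A]
    [IsOrderedAddMonoid A] {f : ℤ → A} {a : ℤ} (h : ∀ n, a ≤ n → fwdDiff (1 : ℤ) f n ≤ 0)
    {m n : ℤ} (hm : a ≤ m) (hmn : m ≤ n) : f n ≤ f m := by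
  induction n, hmn using Int.leInduction with
  | base => exact le_rfl
  | succ n hn ih => exact (sub_nonpos.mp (h n (hm.trans hn))).trans ih

/-- A nonnegative integer valued function has no difference that is eventually nonpositive and
frequently negative. -/
theorem eventually_fwdDiff_iter_eq_zero_of_nonpos (k : ℕ) {f : ℤ → ℤ}
    (hf : ∀ᶠ n in atTop, 0 ≤ f n) (h : ∀ᶠ n in atTop, (fwdDiff (1 : ℤ))^[k] f n ≤ 0) :
    ∀ᶠ n in atTop, (fwdDiff (1 : ℤ))^[k] f n = 0 := by
  induction k with
  | zero => filter_upwards [hf, h] with n h1 h2 using le_antisymm h2 h1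
  | succ k ih =>
    obtain ⟨a, ha⟩ := eventually_atTop.mp h
    have hanti : ∀ m n, a ≤ m → m ≤ n → (fwdDiff (1 : ℤ))^[k] f n ≤ (fwdDiff (1 : ℤ))^[k] f m :=
      fun m n hm hmn => antitone_of_fwdDiff_nonpos
        (fun n hn => (congrFun (Function.iterate_succ_apply' (fwdDiff (1 : ℤ)) k f) n).symm.trans_le
          (ha n hn)) hm hmn
    -- A negative value would persist by antitonicity, against the induction hypothesis, which makes
    -- an eventually nonpositive `k`-th difference eventually zero.
    have hnonneg : ∀ n, a ≤ n → 0 ≤ (fwdDiff (1 : ℤ))^[k] f n := by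
      intro n hn
      by_contra! hneg
      obtain ⟨b, hb⟩ := eventually_atTop.mp (ih (eventually_atTop.mpr
        ⟨n, fun m hm => (hanti n m hn hm).trans hneg.le⟩))
      have := hanti n (max n b) hn (le_max_left _ _)
      rw [hb _ (le_max_right _ _)] at this
      omega
    -- An antitone sequence of nonnegative integers is constant once it attains its minimum.
    obtain ⟨n₀, hn₀, hmin⟩ := (measure fun n => ((fwdDiff (1 : ℤ))^[k] f n).toNat).wf.has_min
      (Set.Ici a) ⟨a, Set.mem_Ici.mpr le_rfl⟩
    have hconst : ∀ n, n₀ ≤ n → (fwdDiff (1 : ℤ))^[k] f n = (fwdDiff (1 : ℤ))^[k] f n₀ := by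
      intro n hn
      have hn₀' : a ≤ n₀ := hn₀
      have h1 := hmin n (Set.mem_Ici.mpr (hn₀'.trans hn))
      have h2 := hanti n₀ n hn₀' hn
      have h3 := hnonneg n (hn₀'.trans hn)
      change ¬ ((fwdDiff (1 : ℤ))^[k] f n).toNat < ((fwdDiff (1 : ℤ))^[k] f n₀).toNat at h1
      omega
    refine eventually_atTop.mpr ⟨n₀, fun n hn => ?_⟩
    rw [Function.iterate_succ_apply', fwdDiff, hconst n hn, hconst (n + 1) (by omega), sub_self]

/-- A function with an eventually vanishing difference is eventually a polynomial. -/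
theorem exists_polynomial_of_fwdDiff_iter_eq_zero (k : ℕ) {f : ℤ → ℚ}
    (h : ∀ᶠ n in atTop, (fwdDiff (1 : ℤ))^[k] f n = 0) :
    ∃ P : ℚ[X], ∀ᶠ n : ℤ in atTop, P.eval (n : ℚ) = f n := by
  obtain ⟨a, ha⟩ := eventually_atTop.mp h
  have hvanish : ∀ j, k ≤ j → (fwdDiff (1 : ℤ))^[j] f a = 0 := by
    have : ∀ i, ∀ n, a ≤ n → (fwdDiff (1 : ℤ))^[i + k] f n = 0 := by
      intro i
      induction i with
      | zero => simpa using ha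
      | succ i ih =>
        intro n hn
        rw [Nat.succ_add, Function.iterate_succ_apply', fwdDiff, ih n hn, ih (n + 1) (by omega),
          sub_zero]
    intro j hj
    rw [← Nat.sub_add_cancel hj]
    exact this _ a le_rfl
  -- Newton's forward interpolation formula at `a`, truncated at order `k`.
  refine ⟨(∑ j ∈ Finset.range k, C ((fwdDiff (1 : ℤ))^[j] f a / j.factorial) *
    descPochhammer ℚ j).comp (X - C (a : ℚ)), eventually_atTop.mpr ⟨a, fun n hn => ?_⟩⟩
  obtain ⟨m, rfl⟩ := Int.le.dest hn
  have hN := shift_eq_sum_fwdDiff_iter (1 : ℤ) f m a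
  rw [nsmul_eq_mul, mul_one] at hN
  rw [hN, eval_comp, eval_finsetSum]
  have e : eval ((a + m : ℤ) : ℚ) (X - C (a : ℚ)) = m := by simp
  rw [e]
  have h1 : ∀ j, (C ((fwdDiff (1 : ℤ))^[j] f a / j.factorial) * descPochhammer ℚ j).eval (m : ℚ) =
      m.choose j • (fwdDiff (1 : ℤ))^[j] f a := by
    intro j
    rw [eval_mul, eval_C, descPochhammer_eval_eq_descFactorial,
      Nat.descFactorial_eq_factorial_mul_choose, nsmul_eq_mul]
    have := Nat.cast_ne_zero (R := ℚ).mpr j.factorial_ne_zero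
    push_cast
    field_simp
  simp_rw [h1]
  rcases le_total k (m + 1) with hk | hk
  · refine Finset.sum_subset (Finset.range_subset_range.mpr hk) fun j _ hj => ?_
    rw [hvanish j (by simpa using hj), smul_zero]
  · refine (Finset.sum_subset (Finset.range_subset_range.mpr hk) fun j _ hj => ?_).symm
    rw [Nat.choose_eq_zero_of_lt (by simpa using hj), zero_smul]

/-- A difference of a polynomial function is again polynomial, so eventual vanishing gives
infinitely many roots. This carries the vanishing from large `n` down to `1 - d`. -/
theorem fwdDiff_iter_eval_eq_zero (P : ℚ[X]) {k : ℕ}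
    (h : ∀ᶠ n in atTop, (fwdDiff (1 : ℤ))^[k] (fun n : ℤ => P.eval (n : ℚ)) n = 0) (n : ℤ) :
    (fwdDiff (1 : ℤ))^[k] (fun n : ℤ => P.eval (n : ℚ)) n = 0 := by
  have key : ∃ Q : ℚ[X], ∀ n : ℤ,
      (fwdDiff (1 : ℤ))^[k] (fun n : ℤ => P.eval (n : ℚ)) n = Q.eval (n : ℚ) := by
    clear h
    induction k with
    | zero => exact ⟨P, fun n => rfl⟩
    | succ k ih =>
      obtain ⟨Q, hQ⟩ := ih
      refine ⟨Q.comp (X + 1) - Q, fun n => ?_⟩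
      rw [Function.iterate_succ_apply', fwdDiff, hQ, hQ]
      simp
  obtain ⟨Q, hQ⟩ := key
  obtain ⟨N, hN⟩ := eventually_atTop.mp h
  have : Q = 0 := by
    refine Polynomial.eq_zero_of_infinite_isRoot Q ?_
    refine ((Set.Ici_infinite N).image (f := fun n : ℤ => (n : ℚ))
      (Int.cast_injective.injOn)).mono ?_
    rintro _ ⟨n, hn, rfl⟩
    exact (hQ n).symm.trans (hN n hn)
  rw [hQ, this, eval_zero]

/-- If a function vanishes eventually, nonnegativity of its `N`-th difference on a half-line
determines the signs of all lower differences there. -/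
theorem neg_one_pow_mul_fwdDiff_iter_nonneg {f : ℤ → ℚ} {a : ℤ} {N : ℕ}
    (hf : ∀ᶠ n in atTop, f n = 0) (h : ∀ n, a ≤ n → 0 ≤ (fwdDiff (1 : ℤ))^[N] f n) {i : ℕ}
    (hi : i ≤ N) (n : ℤ) (hn : a ≤ n) : 0 ≤ (-1 : ℚ) ^ i * (fwdDiff (1 : ℤ))^[N - i] f n := by
  induction i generalizing n with
  | zero => simpa using h n hn
  | succ i ih =>
    obtain ⟨b, hb⟩ := eventually_atTop.mp (eventually_fwdDiff_iter_eq_zero (N - (i + 1)) hf)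
    -- The signed lower difference is antitone by the previous sign and eventually zero, so it is
    -- nonnegative before.
    have := antitone_of_fwdDiff_nonpos (a := a)
      (f := fun n => (-1 : ℚ) ^ (i + 1) * (fwdDiff (1 : ℤ))^[N - (i + 1)] f n) (by
        intro n hn
        have := ih (by omega) n hn
        rw [show N - i = N - (i + 1) + 1 by omega, Function.iterate_succ_apply'] at this
        simp only [fwdDiff] at this ⊢
        rw [pow_succ]
        linarith) hn (le_max_left n b)
    simpa [hb _ (le_max_right n b)] using this

/-! ### The associated graded ring: components, generators and lengths. -/

section AssociatedGraded

variable {R : Type*} [CommRing R] {I : Ideal R}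

/-- The projection of the Rees algebra onto its part of degree `n`. -/
def reesComponent (I : Ideal R) (n : ℕ) : reesAlgebra I →ₗ[R] reesAlgebra I where
  toFun f := ⟨monomial n ((f : R[X]).coeff n), reesAlgebra.monomial_mem.mpr (f.2 n)⟩
  map_add' f g := Subtype.ext (by simp)
  map_smul' r f := Subtype.ext (by simp [smul_monomial])

theorem coe_reesComponent (n : ℕ) (f : reesAlgebra I) :
    (reesComponent I n f : R[X]) = monomial n ((f : R[X]).coeff n) := rfl

theorem reesComponent_mem {f : reesAlgebra I} {n : ℕ} (hf : (f : R[X]).coeff n ∈ I ^ (n + 1)) :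
    reesComponent I n f ∈ initialIdeal I := by
  intro i
  rw [coe_reesComponent, coeff_monomial]
  split_ifs with h
  · exact h ▸ hf
  · exact zero_mem _


theorem gradedComponent_aux (n : ℕ) (f g : reesAlgebra I)
    (h : Ideal.Quotient.mk (initialIdeal I) f = Ideal.Quotient.mk (initialIdeal I) g) :
    Ideal.Quotient.mk (initialIdeal I) (reesComponent I n f) =
      Ideal.Quotient.mk (initialIdeal I) (reesComponent I n g) := by
  rw [Ideal.Quotient.eq] at h ⊢
  rw [← map_sub]
  exact reesComponent_mem (h n)

/-- The projection of the associated graded ring onto its part of degree `n`. -/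
def gradedComponent (I : Ideal R) (n : ℕ) : AssociatedGraded I →ₗ[R] AssociatedGraded I where
  toFun a := Ideal.Quotient.mk (initialIdeal I) (reesComponent I n (Quotient.out a))
  map_add' a b := by
    rw [← map_add, ← map_add]
    refine gradedComponent_aux n _ _ ?_
    rw [map_add]
    simp only [Ideal.Quotient.mk_out]
  map_smul' r a := by
    refine (gradedComponent_aux n _ (r • Quotient.out a) ?_).trans ?_
    · refine (Ideal.Quotient.mk_out _).trans ?_
      refine (congrArg (r • ·) (Ideal.Quotient.mk_out a).symm).trans ?_
      exact ((Ideal.Quotient.mkₐ R (initialIdeal I)).toLinearMap.map_smul r _).symm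
    · rw [map_smul]
      exact (Ideal.Quotient.mkₐ R (initialIdeal I)).toLinearMap.map_smul r _

theorem gradedComponent_mk (n : ℕ) (f : reesAlgebra I) :
    gradedComponent I n (Ideal.Quotient.mk (initialIdeal I) f) =
      Ideal.Quotient.mk (initialIdeal I) (reesComponent I n f) :=
  gradedComponent_aux n _ _ (Ideal.Quotient.mk_out _)

/-- The projection of the associated graded ring onto its part of degree `m ∈ ℤ`. -/
def gradedComponentInt (I : Ideal R) (m : ℤ) : AssociatedGraded I →ₗ[R] AssociatedGraded I :=
  if 0 ≤ m then gradedComponent I m.toNat else 0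

theorem gradedComponentInt_of_nonneg (n : ℕ) : gradedComponentInt I n = gradedComponent I n :=
  if_pos (Int.natCast_nonneg n)

theorem gradedComponentInt_of_neg {m : ℤ} (hm : m < 0) : gradedComponentInt I m = 0 :=
  if_neg (not_le.mpr hm)

theorem gradedComponentInt_idem (m : ℤ) (a : AssociatedGraded I) :
    gradedComponentInt I m (gradedComponentInt I m a) = gradedComponentInt I m a := by
  rcases lt_or_ge m 0 with hm | hm
  · rw [gradedComponentInt_of_neg hm]
    rfl
  · lift m to ℕ using hm
    obtain ⟨f, rfl⟩ := Ideal.Quotient.mk_surjective a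
    rw [gradedComponentInt_of_nonneg, gradedComponent_mk, gradedComponent_mk]
    congr 1
    exact Subtype.ext (by simp [coe_reesComponent])

/-- The element of degree one of the associated graded ring given by an element of `I`. -/
def initialFormOne (y : I) : AssociatedGraded I :=
  Ideal.Quotient.mk (initialIdeal I)
    ⟨monomial 1 (y : R), reesAlgebra.monomial_mem.mpr (by rw [pow_one]; exact y.2)⟩

theorem gradedComponentInt_initialFormOne_mul (y : I) (m : ℤ) (a : AssociatedGraded I) :
    gradedComponentInt I m (initialFormOne y * a) =
      initialFormOne y * gradedComponentInt I (m - 1) a := by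
  rcases lt_or_ge m 0 with hm | hm
  · rw [gradedComponentInt_of_neg hm, gradedComponentInt_of_neg (by omega)]
    simp
  lift m to ℕ using hm
  obtain ⟨f, rfl⟩ := Ideal.Quotient.mk_surjective a
  rw [initialFormOne, ← map_mul, gradedComponentInt_of_nonneg, gradedComponent_mk]
  obtain _ | n := m
  · rw [gradedComponentInt_of_neg (by simp), LinearMap.zero_apply, mul_zero]
    have : reesComponent I 0 (⟨monomial 1 (y : R), reesAlgebra.monomial_mem.mpr
        (by rw [pow_one]; exact y.2)⟩ * f) = 0 := Subtype.ext (by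
      simp [coe_reesComponent, mul_coeff_zero, coeff_monomial])
    rw [this, map_zero]
  · rw [show ((n + 1 : ℕ) : ℤ) - 1 = n by simp, gradedComponentInt_of_nonneg, gradedComponent_mk,
      ← map_mul]
    congr 1
    refine Subtype.ext ?_
    simp [coe_reesComponent, coeff_monomial_mul, monomial_mul_monomial, add_comm]

variable {k : ℕ} {y : ℕ → I}

/-- By `I ^ (n + 1) = I * I ^ n`, forms of positive degree are combinations of degree one forms, and
these are combinations of the initial forms of the generators (`hone`). -/
theorem mk_mem_span_initialFormOne (hy : I = Ideal.span ((fun j => (y j : R)) '' {j | j < k}))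
    (n : ℕ) (c : R) (hc : c ∈ I ^ (n + 1)) (f : reesAlgebra I)
    (hf : (f : R[X]) = monomial (n + 1) c) :
    Ideal.Quotient.mk (initialIdeal I) f ∈
      Ideal.span ((fun j => initialFormOne (y j)) '' {j | j < k}) := by
  have hone : ∀ r (hr : r ∈ I) (f : reesAlgebra I), (f : R[X]) = monomial 1 r →
      Ideal.Quotient.mk (initialIdeal I) f ∈
        Ideal.span ((fun j => initialFormOne (y j)) '' {j | j < k}) := by
    intro r hr
    have hr' : r ∈ Ideal.span ((fun j => (y j : R)) '' {j | j < k}) := hy.le hr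
    induction hr' using Submodule.span_induction with
    | mem r h =>
      obtain ⟨j, hj, rfl⟩ := h
      intro f hf
      have : f = ⟨monomial 1 (y j : R), reesAlgebra.monomial_mem.mpr (by rw [pow_one]; exact hr)⟩ :=
        Subtype.ext hf
      rw [this]
      exact Ideal.subset_span ⟨j, hj, rfl⟩
    | zero =>
      intro f hf
      have : f = 0 := Subtype.ext (by simpa using hf)
      rw [this, map_zero]
      exact zero_mem _
    | add r s hr' hs' ihr ihs =>
      intro f hf
      have hr : r ∈ I := hy.ge hr'
      have hs : s ∈ I := hy.ge hs'
      let fr : reesAlgebra I := ⟨monomial 1 r, reesAlgebra.monomial_mem.mpr (by rwa [pow_one])⟩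
      let fs : reesAlgebra I := ⟨monomial 1 s, reesAlgebra.monomial_mem.mpr (by rwa [pow_one])⟩
      have : f = fr + fs := Subtype.ext (by simpa [fr, fs] using hf)
      rw [this, map_add]
      exact add_mem (ihr hr fr rfl) (ihs hs fs rfl)
    | smul a r hr' ihr =>
      intro f hf
      have hr : r ∈ I := hy.ge hr'
      let fr : reesAlgebra I := ⟨monomial 1 r, reesAlgebra.monomial_mem.mpr (by rwa [pow_one])⟩
      have : f = algebraMap R (reesAlgebra I) a * fr := Subtype.ext (by
        refine hf.trans ?_
        change _ = C a * monomial 1 r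
        rw [C_mul_monomial, smul_eq_mul])
      rw [this, map_mul]
      exact Ideal.mul_mem_left _ _ (ihr hr fr rfl)
  rw [pow_succ'] at hc
  induction hc using Submodule.mul_induction_on' generalizing f with
  | mem_mul_mem r hr s hs =>
    let fr : reesAlgebra I := ⟨monomial 1 r, reesAlgebra.monomial_mem.mpr (by rwa [pow_one])⟩
    let fs : reesAlgebra I := ⟨monomial n s, reesAlgebra.monomial_mem.mpr hs⟩
    have : f = fs * fr := Subtype.ext (by
      refine hf.trans ?_
      change _ = monomial n s * monomial 1 r
      rw [monomial_mul_monomial, mul_comm])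
    rw [this, map_mul]
    exact Ideal.mul_mem_left _ _ (hone r hr fr rfl)
  | add r hr s hs ihr ihs =>
    rw [← pow_succ'] at hr hs
    let fr : reesAlgebra I := ⟨monomial (n + 1) r, reesAlgebra.monomial_mem.mpr hr⟩
    let fs : reesAlgebra I := ⟨monomial (n + 1) s, reesAlgebra.monomial_mem.mpr hs⟩
    have : f = fr + fs := Subtype.ext (by simpa [fr, fs] using hf)
    rw [this, map_add]
    exact add_mem (ihr fr rfl) (ihs fs rfl)

theorem gradedComponentInt_mem_span
    (hy : I = Ideal.span ((fun j => (y j : R)) '' {j | j < k})) {m : ℤ} (hm : 1 ≤ m)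
    (a : AssociatedGraded I) :
    gradedComponentInt I m a ∈ Ideal.span ((fun j => initialFormOne (y j)) '' {j | j < k}) := by
  obtain ⟨n, rfl⟩ := Int.le.dest hm
  obtain ⟨f, rfl⟩ := Ideal.Quotient.mk_surjective a
  rw [show (1 + n : ℤ) = ((n + 1 : ℕ) : ℤ) by push_cast; ring, gradedComponentInt_of_nonneg,
    gradedComponent_mk]
  exact mk_mem_span_initialFormOne hy n _ (f.2 (n + 1)) _ rfl

theorem mk_mem_span_of_coeff_zero_mem
    (hy : I = Ideal.span ((fun j => (y j : R)) '' {j | j < k})) {f : reesAlgebra I}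
    (hf : (f : R[X]).coeff 0 ∈ I) :
    Ideal.Quotient.mk (initialIdeal I) f ∈
      Ideal.span ((fun j => initialFormOne (y j)) '' {j | j < k}) := by
  have hsum : f = ∑ n ∈ (f : R[X]).support, reesComponent I n f := Subtype.ext (by
    rw [AddSubmonoidClass.coe_finsetSum]
    exact (f : R[X]).as_sum_support)
  rw [hsum, map_sum]
  refine sum_mem fun n _ => ?_
  obtain _ | n := n
  · have h0 : reesComponent I 0 f ∈ initialIdeal I := reesComponent_mem (by simpa using hf)
    rw [Ideal.Quotient.eq_zero_iff_mem.mpr h0]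
    exact zero_mem _
  · exact mk_mem_span_initialFormOne hy n _ (f.2 (n + 1)) _ rfl

/-- A power of the constant coefficient lies in `I`, so its class in degree `0` vanishes and only
positive degrees remain. -/
theorem mem_radical_of_mem_homogeneousMaximalIdeal [IsLocalRing R]
    (hy : I = Ideal.span ((fun j => (y j : R)) '' {j | j < k}))
    (hI : I.radical = IsLocalRing.maximalIdeal R) {r : AssociatedGraded I}
    (hr : r ∈ homogeneousMaximalIdeal I) :
    r ∈ (Ideal.span ((fun j => initialFormOne (y j)) '' {j | j < k})).radical := by
  obtain ⟨f, hf, rfl⟩ := (Ideal.mem_map_iff_of_surjective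
    (Ideal.Quotient.mk (initialIdeal I)) Ideal.Quotient.mk_surjective).mp hr
  have hf' : (f : R[X]).coeff 0 ∈ I.radical := hI ▸ hf
  obtain ⟨N, hN⟩ := hf'
  refine ⟨N, ?_⟩
  rw [← map_pow]
  refine mk_mem_span_of_coeff_zero_mem hy ?_
  change ((f : R[X]) ^ N).coeff 0 ∈ I
  rw [coeff_zero_eq_eval_zero, eval_pow, ← coeff_zero_eq_eval_zero]
  exact hN

/-- Additivity of length on `0 → Iⁿ/Iⁿ⁺¹ → R/Iⁿ⁺¹ → R/Iⁿ → 0`. The maps `φ` and `ψ` out of `Iⁿ` have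
the same kernel `Iⁿ⁺¹`, which identifies the degree `n` component with the left term. -/
theorem length_quotient_pow_succ (n : ℕ) :
    Module.length R (R ⧸ I ^ (n + 1)) =
      Module.length R (LinearMap.range (gradedComponent I n)) + Module.length R (R ⧸ I ^ n) := by
  have hle : I ^ (n + 1) ≤ I ^ n := Ideal.pow_le_pow_right n.le_succ
  let φ : (I ^ n : Ideal R) →ₗ[R] AssociatedGraded I :=
    { toFun := fun c => Ideal.Quotient.mk (initialIdeal I)
        ⟨monomial n (c : R), reesAlgebra.monomial_mem.mpr c.2⟩
      map_add' := fun c d => by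
        rw [← map_add]
        congr 1
        exact Subtype.ext (by simp)
      map_smul' := fun r c => by
        refine Eq.trans ?_ ((Ideal.Quotient.mkₐ R (initialIdeal I)).toLinearMap.map_smul r _)
        refine congrArg (Ideal.Quotient.mk (initialIdeal I)) (Subtype.ext ?_)
        simp [smul_monomial] }
  have hφ : LinearMap.range φ = LinearMap.range (gradedComponent I n) := by
    apply le_antisymm
    · rintro _ ⟨c, rfl⟩
      refine ⟨φ c, ?_⟩
      refine (gradedComponent_mk n _).trans (congrArg _ (Subtype.ext ?_))
      simp [coe_reesComponent]
    · rintro _ ⟨a, rfl⟩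
      obtain ⟨f, rfl⟩ := Ideal.Quotient.mk_surjective a
      exact ⟨⟨_, f.2 n⟩, (gradedComponent_mk n f).symm⟩
  have hker : ∀ c : (I ^ n : Ideal R), φ c = 0 ↔ (c : R) ∈ I ^ (n + 1) := by
    intro c
    refine Ideal.Quotient.eq_zero_iff_mem.trans ⟨fun h => ?_, fun h i => ?_⟩
    · simpa using h n
    · change (monomial n (c : R)).coeff i ∈ _
      rw [coeff_monomial]
      split_ifs with hi
      · exact hi ▸ h
      · exact zero_mem _
  let ψ : (I ^ n : Ideal R) →ₗ[R] R ⧸ I ^ (n + 1) :=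
    (Submodule.mkQ (I ^ (n + 1))).comp (Submodule.subtype (I ^ n))
  have hψ : LinearMap.ker ψ = LinearMap.ker φ := by
    ext c
    rw [LinearMap.mem_ker, LinearMap.mem_ker, hker]
    exact Submodule.Quotient.mk_eq_zero _
  have e : LinearMap.range (gradedComponent I n) ≃ₗ[R] LinearMap.range ψ :=
    (LinearEquiv.ofEq _ _ hφ.symm).trans (φ.quotKerEquivRange.symm.trans
      ((Submodule.quotEquivOfEq _ _ hψ.symm).trans ψ.quotKerEquivRange))
  rw [e.length_eq]
  refine Module.length_eq_add_of_exact (LinearMap.range ψ).subtype (Submodule.factor hle)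
    (Submodule.subtype_injective _) (Submodule.factor_surjective hle) ?_
  intro a
  obtain ⟨a, rfl⟩ := Submodule.mkQ_surjective _ a
  have h1 : Submodule.factor hle (Submodule.mkQ _ a) = Submodule.mkQ (I ^ n) a := rfl
  rw [h1, Submodule.mkQ_apply, Submodule.Quotient.mk_eq_zero]
  constructor
  · intro ha
    exact ⟨⟨_, ⟨⟨a, ha⟩, rfl⟩⟩, rfl⟩
  · rintro ⟨⟨_, ⟨⟨b, hb⟩, rfl⟩⟩, hba⟩
    have h2 : (Submodule.mkQ (I ^ (n + 1))) b = Submodule.mkQ (I ^ (n + 1)) a := hba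
    rw [Submodule.mkQ_apply, Submodule.mkQ_apply, Submodule.Quotient.eq] at h2
    exact (Submodule.sub_mem_iff_right _ hb).mp (hle h2)

theorem length_quotient_pow_ne_top [IsLocalRing R] [IsNoetherianRing R]
    (hI : I.radical = IsLocalRing.maximalIdeal R) (n : ℕ) : Module.length R (R ⧸ I ^ n) ≠ ⊤ := by
  obtain _ | n := n
  · have : Subsingleton (R ⧸ I ^ 0) := Ideal.Quotient.subsingleton_iff.mpr (by simp)
    rw [Module.length_eq_zero]
    exact ENat.zero_ne_top
  -- The maximal ideal is a minimal prime over `I ^ (n + 1)`, because it is the radical of that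
  -- power.
  · have : IsArtinianRing (R ⧸ I ^ (n + 1)) := by
      refine IsLocalRing.quotient_artinian_of_mem_minimalPrimes_of_isLocalRing _
        ⟨⟨(IsLocalRing.maximalIdeal.isMaximal R).isPrime, ?_⟩, ?_⟩
      · exact (Ideal.pow_le_self n.succ_ne_zero).trans (Ideal.le_radical.trans hI.le)
      · rintro p ⟨hp, hp'⟩ -
        rw [← hI, ← Ideal.radical_pow I n.succ_ne_zero]
        exact hp.radical_le_iff.mpr hp'
    rw [Module.length_eq_of_surjective (R := R ⧸ I ^ (n + 1)) Ideal.Quotient.mk_surjective]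
    exact Module.length_ne_top

theorem length_range_gradedComponentInt [IsLocalRing R] [IsNoetherianRing R]
    (hI : I.radical = IsLocalRing.maximalIdeal R) (m : ℤ) :
    ∃ g : ℕ, Module.length R (LinearMap.range (gradedComponentInt I m)) = g ∧
      fwdDiff (1 : ℤ) (hilbertFunction I) m = g := by
  rcases lt_or_ge m 0 with hm | hm
  · refine ⟨0, ?_, ?_⟩
    · rw [gradedComponentInt_of_neg hm, LinearMap.range_zero, Module.length_bot, Nat.cast_zero]
    · rw [fwdDiff, hilbertFunction, hilbertFunction, Int.toNat_of_nonpos (by omega),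
        Int.toNat_of_nonpos (by omega)]
      simp
  · lift m to ℕ using hm
    have h := length_quotient_pow_succ (I := I) m
    obtain ⟨a, ha⟩ := ENat.ne_top_iff_exists.mp (length_quotient_pow_ne_top hI m)
    obtain ⟨b, hb⟩ := ENat.ne_top_iff_exists.mp (length_quotient_pow_ne_top hI (m + 1))
    have hg : Module.length R (LinearMap.range (gradedComponent I m)) ≠ ⊤ := by
      intro h'
      rw [h', top_add] at h
      exact length_quotient_pow_ne_top hI (m + 1) h
    obtain ⟨g, hg⟩ := ENat.ne_top_iff_exists.mp hg
    refine ⟨g, by rw [gradedComponentInt_of_nonneg, hg], ?_⟩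
    rw [← ha, ← hb, ← hg] at h
    norm_cast at h
    rw [fwdDiff, hilbertFunction, hilbertFunction, show ((m : ℤ) + 1).toNat = m + 1 by omega,
      Int.toNat_natCast, ← ha, ← hb, ENat.toNat_natCast, ENat.toNat_natCast, h]
    push_cast
    ring

theorem exists_isRegular_of_le_depth [IsLocalRing R] {d : ℕ}
    (h : (d : ℕ∞) ≤ depthAssociatedGraded I + 1) :
    ∃ rs : List (AssociatedGraded I), (∀ r ∈ rs, r ∈ homogeneousMaximalIdeal I) ∧
      RingTheory.Sequence.IsWeaklyRegular (AssociatedGraded I) rs ∧ d < 2 + rs.length := by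
  rcases lt_or_ge d 2 with hd | hd
  · exact ⟨[], by simp, RingTheory.Sequence.IsWeaklyRegular.nil _ _, by simpa using hd⟩
  · obtain ⟨d, rfl⟩ := Nat.exists_eq_add_of_le' hd
    -- The strict inequality yields an actual sequence longer than `d` (the original dimension minus
    -- two), even if the supremum is not attained.
    have h' : (d : ℕ∞) < depthAssociatedGraded I := by
      by_contra! hcon
      have := h.trans (add_le_add_left hcon 1)
      norm_cast at this
      omega
    simp only [depthAssociatedGraded, lt_iSup_iff] at h'
    obtain ⟨rs, ⟨h1, h2⟩, h3⟩ := h'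
    refine ⟨rs, h1, h2.toIsWeaklyRegular, ?_⟩
    norm_cast at h3
    omega

/-- The differences of order `d + 1` of the Hilbert function of a parameter ideal whose associated
graded ring has depth at least `d - 1`. -/
theorem fwdDiff_iter_hilbertFunction_nonpos [IsLocalRing R] [IsNoetherianRing R] {d : ℕ}
    (hd : ringKrullDim R = d) (hI : IsParameterIdeal I)
    (hdepth : (d : ℕ∞) ≤ depthAssociatedGraded I + 1) (n : ℤ) (hn : 1 - (d : ℤ) ≤ n) :
    (fwdDiff (1 : ℤ))^[d + 1] (hilbertFunction I) n ≤ 0 := by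
  obtain ⟨d', x, hd', hx, hrad⟩ := hI
  obtain rfl : d' = d := by
    rw [hd] at hd'
    exact_mod_cast hd'.symm
  obtain ⟨rs, hmem, hreg, hlen⟩ := exists_isRegular_of_le_depth hdepth
  have hxI : ∀ j, x j ∈ I := fun j => hx ▸ Ideal.subset_span ⟨j, rfl⟩
  -- The Koszul complex is built from an infinite sequence, so the parameters are padded by zero.
  let y : ℕ → I := fun j => if h : j < d' then ⟨x ⟨j, h⟩, hxI _⟩ else 0
  have hy : I = Ideal.span ((fun j => (y j : R)) '' {j | j < d'}) := by
    refine hx.trans (congrArg Ideal.span ?_)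
    ext r
    constructor
    · rintro ⟨j, rfl⟩
      exact ⟨j, j.2, by simp [y]⟩
    · rintro ⟨j, hj, rfl⟩
      have hj : j < d' := hj
      exact ⟨⟨j, hj⟩, by simp [y, hj]⟩
  choose g hg hg' using length_range_gradedComponentInt hrad
  -- The relevant strand has internal degree `n + d'`; the bound `n ≥ 1 - d'` says exactly that it
  -- is positive, so `H_0` vanishes there.
  rw [Function.iterate_succ_apply, funext hg', show n = n + d' - d' by ring]
  exact fwdDiff_iter_length_nonpos
    (fun m j a => gradedComponentInt_initialFormOne_mul (y j) m a) gradedComponentInt_idem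
    (fun a => gradedComponentInt_mem_span hy (by omega) a) rs hreg
    (fun r hr => mem_radical_of_mem_homogeneousMaximalIdeal hy hrad (hmem r hr)) hlen hg

end AssociatedGraded

/-! ### Passage to rational values and the final assembly. -/

theorem fwdDiff_iter_intCast (k : ℕ) (f : ℤ → ℤ) (n : ℤ) :
    (fwdDiff (1 : ℤ))^[k] (fun m => (f m : ℚ)) n = ((fwdDiff (1 : ℤ))^[k] f n : ℤ) := by
  induction k generalizing n with
  | zero => rfl
  | succ k ih =>
    rw [Function.iterate_succ_apply', Function.iterate_succ_apply', fwdDiff, fwdDiff, ih, ih]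
    push_cast
    rfl

theorem isHilbertSamuelPolynomial_hilbertSamuelPolynomial {R : Type*} [CommRing R] {I : Ideal R}
    (h : ∃ P : ℚ[X], IsHilbertSamuelPolynomial I P) :
    IsHilbertSamuelPolynomial I (hilbertSamuelPolynomial I) := by
  rw [hilbertSamuelPolynomial, dif_pos h]
  exact h.choose_spec

end HilbertDelta

end

open HilbertDelta in
theorem theorem4p1 {R : Type*} [CommRing R] [IsLocalRing R] [IsNoetherianRing R]
    (d : ℕ) (hd : ringKrullDim R = d)
    (q : Ideal R) (hq : HilbertDelta.IsParameterIdeal q)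
    (hdepth : (d : ℕ∞) ≤ HilbertDelta.depthAssociatedGraded q + 1) :
    HilbertDelta.IsHilbertSamuelPolynomial q (HilbertDelta.hilbertSamuelPolynomial q) ∧
    ∀ i : ℕ, i ≤ d + 1 → ∀ n : ℤ, 1 - (d : ℤ) ≤ n →
      0 ≤ (-1 : ℚ) ^ i *
        (fwdDiff (1 : ℤ))^[d + 1 - i]
          (fun m : ℤ => (HilbertDelta.hilbertSamuelPolynomial q).eval (m : ℚ) -
            (HilbertDelta.hilbertFunction q m : ℚ)) n := by
  have hneg := fwdDiff_iter_hilbertFunction_nonpos hd hq hdepth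
  have hzero := eventually_fwdDiff_iter_eq_zero_of_nonpos (d + 1) (f := hilbertFunction q)
    (Eventually.of_forall fun n => Int.natCast_nonneg _) (eventually_atTop.mpr ⟨_, hneg⟩)
  have hzero' : ∀ᶠ n in atTop,
      (fwdDiff (1 : ℤ))^[d + 1] (fun m => (hilbertFunction q m : ℚ)) n = 0 := by
    filter_upwards [hzero] with n hn
    rw [fwdDiff_iter_intCast, hn, Int.cast_zero]
  have hP := isHilbertSamuelPolynomial_hilbertSamuelPolynomial
    (exists_polynomial_of_fwdDiff_iter_eq_zero (d + 1) hzero')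
  have hsub : ∀ n, (fwdDiff (1 : ℤ))^[d + 1] (fun m : ℤ =>
      (hilbertSamuelPolynomial q).eval (m : ℚ) - (hilbertFunction q m : ℚ)) n =
      (fwdDiff (1 : ℤ))^[d + 1] (fun m : ℤ => (hilbertSamuelPolynomial q).eval (m : ℚ)) n -
        (fwdDiff (1 : ℤ))^[d + 1] (fun m => (hilbertFunction q m : ℚ)) n := by
    intro n
    have := congrFun (fwdDiff_iter_add (1 : ℤ) (fun m : ℤ =>
      (hilbertSamuelPolynomial q).eval (m : ℚ) - (hilbertFunction q m : ℚ))
      (fun m => (hilbertFunction q m : ℚ)) (d + 1)) n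
    rw [eq_sub_iff_add_eq]
    refine this.symm.trans (congrArg (fun f => (fwdDiff (1 : ℤ))^[d + 1] f n) ?_)
    funext m
    exact sub_add_cancel _ _
  have hdiff : ∀ᶠ n : ℤ in atTop,
      (hilbertSamuelPolynomial q).eval (n : ℚ) - (hilbertFunction q n : ℚ) = 0 := by
    filter_upwards [hP] with n hn
    rw [hn, sub_self]
  refine ⟨hP, fun i hi n hn => neg_one_pow_mul_fwdDiff_iter_nonneg hdiff ?_ hi n hn⟩
  intro m hm
  -- The difference of order `d + 1` of `P_q` vanishes identically, so that of `P_q - H_q` is the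
  -- negative of that of `H_q`.
  have hPzero := fwdDiff_iter_eval_eq_zero (hilbertSamuelPolynomial q) (k := d + 1) (by
    filter_upwards [hzero', eventually_fwdDiff_iter_eq_zero (d + 1) hdiff] with n h1 h2
    rwa [hsub, h1, sub_zero] at h2)
  rw [hsub, hPzero, zero_sub, fwdDiff_iter_intCast, Left.nonneg_neg_iff]
  exact_mod_cast hneg m hm
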